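/- Let $(\Omega,\mathcal M,\mathbb P)$ be a probability space, let $p\in[1,\infty]$ and let $\mathcal L^p=\mathcal L^p(\Omega,\mathcal M,\mathbb P)$ be the normed space of real random variables with finite $p$-norm, random variables that agree almost surely being identified. A functional $F:\mathcal L^p\to(-\infty,\infty]$ is called closed convex if it is convex and lower semicontinuous for the norm of $\mathcal L^p$. Such a functional is called - a subregular error measure if $F(0)=0$, $F(X)\ge 0$ for all $X$, and for every $X\neq 0$ there is $\lambda>0$ with $F(\lambda X)>0$; - a subregular regret measure if $F(0)=0$, $F(X)\ge\mathbb E[X]$ for all $X$, and for every $X\ne 0$ there is $\lambda>0$ with $F(\lambda X)>\mathbb E[\lambda X]$; - a subregular deviation measure if $F(C)=0$ for all constants $C$, $F(X)\ge 0$ for all $X$, and for every non-constant $X$ there is $\lambda>0$ with $F(\lambda X)>0$; - a subregular risk measure if $F(C)=C$ for all constants $C$, $F(X)\ge\mathbb E[X]$ for all $X$, and for every non-constant $X$ there is $\lambda>0$ with $F(\lambda X)>\mathbb E[\lambda X]$. It is called positively homogeneous if $F(\lambda X)=\lambda F(X)$ for all $X\in\mathcal L^p$ and all $\lambda\ge 0$,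 where $0\cdot\infty=0$. For $\tau>0$ put $$F_\tau(X)=\inf_{\lambda>0}\lambda\bigl[F(\lambda^{-1}X)+\tau\bigr],\qquad X\in\mathcal L^p.$$ Then for every $\tau>0$: if $F$ is a subregular error measure, a subregular regret measure, a subregular deviation measure, or a subregular risk measure, then $F_\tau$ is a positively homogeneous subregular error measure, regret measure, deviation measure, or risk measure, respectively. (In particular $F_\tau$ is again closed and convex and never takes the value $-\infty$.) -/

import Mathlib

open MeasureTheory
open scoped ENNReal

namespace RiskQuadrangle

/-- Closed (that is, lower semicontinuous for the norm of `L^p`) convex functionals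
`L^p → (-∞, ∞]`. Values are taken in `EReal`, where `0 * ⊤ = 0`. -/
structure IsClosedConvex {Ω : Type*} [MeasurableSpace Ω] {P : Measure Ω} {p : ℝ≥0∞}
    [Fact (1 ≤ p)] (F : Lp ℝ p P → EReal) : Prop where
  ne_bot : ∀ X, F X ≠ ⊥
  convex : ∀ (X Y : Lp ℝ p P) (a : ℝ), 0 ≤ a → a ≤ 1 →
    F (a • X + (1 - a) • Y) ≤ (a : EReal) * F X + ((1 - a : ℝ) : EReal) * F Y
  closed : LowerSemicontinuous F

/-- The expectation `E[X]`, as an extended real number. -/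
noncomputable def expect {Ω : Type*} [MeasurableSpace Ω] {P : Measure Ω} {p : ℝ≥0∞}
    (X : Lp ℝ p P) : EReal :=
  ((∫ ω, X ω ∂P : ℝ) : EReal)

/-- `X` is (almost surely) equal to a constant. -/
def IsConstant {Ω : Type*} [MeasurableSpace Ω] {P : Measure Ω} [IsProbabilityMeasure P]
    {p : ℝ≥0∞} (X : Lp ℝ p P) : Prop :=
  ∃ c : ℝ, X = Lp.const p P c

/-- Subregular measures of risk. -/
structure IsSubregularRisk {Ω : Type*} [MeasurableSpace Ω] {P : Measure Ω}
    [IsProbabilityMeasure P] {p : ℝ≥0∞} [Fact (1 ≤ p)] (R : Lp ℝ p P → EReal) : Prop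
    extends IsClosedConvex R where
  map_const : ∀ c : ℝ, R (Lp.const p P c) = (c : EReal)
  expect_le : ∀ X, expect X ≤ R X
  subaversity : ∀ X : Lp ℝ p P, ¬ IsConstant X →
    ∃ l : ℝ, 0 < l ∧ expect (l • X) < R (l • X)

/-- Subregular measures of deviation; `nonneg` says that the values lie in `[0, ∞]`. -/
structure IsSubregularDeviation {Ω : Type*} [MeasurableSpace Ω] {P : Measure Ω}
    [IsProbabilityMeasure P] {p : ℝ≥0∞} [Fact (1 ≤ p)] (D : Lp ℝ p P → EReal) : Prop
    extends IsClosedConvex D where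
  map_const : ∀ c : ℝ, D (Lp.const p P c) = 0
  nonneg : ∀ X, 0 ≤ D X
  subaversity : ∀ X : Lp ℝ p P, ¬ IsConstant X → ∃ l : ℝ, 0 < l ∧ 0 < D (l • X)

/-- Subregular measures of regret. -/
structure IsSubregularRegret {Ω : Type*} [MeasurableSpace Ω] {P : Measure Ω}
    [IsProbabilityMeasure P] {p : ℝ≥0∞} [Fact (1 ≤ p)] (V : Lp ℝ p P → EReal) : Prop
    extends IsClosedConvex V where
  map_zero : V 0 = 0
  expect_le : ∀ X, expect X ≤ V X
  subaversity : ∀ X : Lp ℝ p P, X ≠ 0 →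
    ∃ l : ℝ, 0 < l ∧ expect (l • X) < V (l • X)

/-- Subregular measures of error; `nonneg` says that the values lie in `[0, ∞]`. -/
structure IsSubregularError {Ω : Type*} [MeasurableSpace Ω] {P : Measure Ω}
    [IsProbabilityMeasure P] {p : ℝ≥0∞} [Fact (1 ≤ p)] (E : Lp ℝ p P → EReal) : Prop
    extends IsClosedConvex E where
  map_zero : E 0 = 0
  nonneg : ∀ X, 0 ≤ E X
  subaversity : ∀ X : Lp ℝ p P, X ≠ 0 → ∃ l : ℝ, 0 < l ∧ 0 < E (l • X)

/-- Positive homogeneity: `F (l X) = l F X` for all `l ≥ 0`, with `0 · ∞ = 0`. -/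
def IsPosHomogeneous {Ω : Type*} [MeasurableSpace Ω] {P : Measure Ω} {p : ℝ≥0∞}
    (F : Lp ℝ p P → EReal) : Prop :=
  ∀ (X : Lp ℝ p P) (l : ℝ), 0 ≤ l → F (l • X) = (l : EReal) * F X

/-- The family `F_τ(X) = inf_{l > 0} l (F(X / l) + τ)` obtained from the parent functional `F`
by the perspective transform. -/
noncomputable def perspectiveFamily {Ω : Type*} [MeasurableSpace Ω] {P : Measure Ω} {p : ℝ≥0∞}
    (F : Lp ℝ p P → EReal) (τ : ℝ) : Lp ℝ p P → EReal :=
  fun X => ⨅ (l : ℝ) (_ : 0 < l), (l : EReal) * (F (l⁻¹ • X) + (τ : EReal))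

end RiskQuadrangle

/-!
Reading the infimum along the ray through `x` in the variable `s = 1 / l`, one has `F_τ x < a` if
and only if `F (s x) < s a - τ` for some `s > 0`. Convexity and `F 0 = 0` make the slopes
`F (s x) / s` nondecreasing in `s`, so in proving lower semicontinuity the parameters `s` beyond
some `T` are controlled by `s = T` alone, and the remaining `s ∈ [0, T]` by compactness; `s = 0` is
harmless because `F 0 = 0 > -τ`. Monotone slopes also show that `F_τ` lies strictly above a linear
minorant of `F` at `x` as soon as `F` does somewhere on the ray through `x`. The four classes are
instances of one notion: the minorant is `0` or the expectation, and `F` agrees with it on the zero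
subspace or on the constants, but identically on no ray outside it.
-/

open Filter Topology Set

namespace RiskQuadrangle

section ExtendedReal

variable {E : Type*} [AddCommGroup E] [Module ℝ E] {f : E → EReal} {x y : E}

/-- Convexity of an extended-real-valued function on a real vector space. Mathlib's `ConvexOn` does
not apply, since `EReal` is not a real module. -/
def IsConvex (f : E → EReal) : Prop :=
  ∀ (x y : E) (a : ℝ), 0 ≤ a → a ≤ 1 →
    f (a • x + (1 - a) • y) ≤ (a : EReal) * f x + ((1 - a : ℝ) : EReal) * f y

lemma IsConvex.map_add_le_coe (hf : IsConvex f) {a r s : ℝ} (ha₀ : 0 ≤ a) (ha₁ : a ≤ 1)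
    (hx : f x ≤ r) (hy : f y ≤ s) :
    f (a • x + (1 - a) • y) ≤ ((a * r + (1 - a) * s : ℝ) : EReal) := by
  rw [EReal.coe_add, EReal.coe_mul, EReal.coe_mul]
  exact (hf x y a ha₀ ha₁).trans <| add_le_add
    (mul_le_mul_of_nonneg_left hx (EReal.coe_nonneg.2 ha₀))
    (mul_le_mul_of_nonneg_left hy (EReal.coe_nonneg.2 (sub_nonneg.2 ha₁)))

lemma IsConvex.mul_lt_map_smul_of_le (hf : IsConvex f) (hf₀ : f 0 ≤ 0) {s t c : ℝ} (hs : 0 < s)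
    (hst : s ≤ t) (h : ((s * c : ℝ) : EReal) < f (s • x)) :
    ((t * c : ℝ) : EReal) < f (t • x) := by
  have ht : 0 < t := hs.trans_le hst
  contrapose! h
  have hle := hf.map_add_le_coe (div_nonneg hs.le ht.le) ((div_le_one ht).2 hst) h hf₀
  rwa [smul_zero, add_zero, smul_smul, mul_zero, add_zero, ← mul_assoc,
    div_mul_cancel₀ s ht.ne'] at hle

lemma coe_mul_add_lt_coe_iff {l τ a : ℝ} {y : EReal} (hl : 0 < l) :
    (l : EReal) * (y + (τ : EReal)) < a ↔ y < ((l⁻¹ * a - τ : ℝ) : EReal) := by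
  induction y using EReal.rec with
  | bot =>
    rw [EReal.bot_add, EReal.coe_mul_bot_of_pos hl]
    exact iff_of_true (EReal.bot_lt_coe _) (EReal.bot_lt_coe _)
  | top => simp [EReal.coe_mul_top_of_pos hl]
  | coe r =>
    rw [← EReal.coe_add, ← EReal.coe_mul, EReal.coe_lt_coe_iff, EReal.coe_lt_coe_iff,
      lt_sub_iff_add_lt, lt_inv_mul_iff₀ hl]

end ExtendedReal

section Perspective

variable {E : Type*} [AddCommGroup E] [Module ℝ E] {f : E → EReal} {τ a c : ℝ} {x y : E}

/-- The perspective transform `inf_{l > 0} l (f (x / l) + τ)` on an arbitrary real vector space;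
on `L^p` it is `perspectiveFamily`. -/
noncomputable def perspectiveInf (f : E → EReal) (τ : ℝ) (x : E) : EReal :=
  ⨅ (l : ℝ) (_ : 0 < l), (l : EReal) * (f (l⁻¹ • x) + (τ : EReal))

lemma perspectiveInf_lt_coe_iff :
    perspectiveInf f τ x < a ↔ ∃ s : ℝ, 0 < s ∧ f (s • x) < ((s * a - τ : ℝ) : EReal) := by
  simp only [perspectiveInf, iInf_lt_iff]
  constructor
  · rintro ⟨l, hl, h⟩
    exact ⟨l⁻¹, inv_pos.2 hl, (coe_mul_add_lt_coe_iff hl).1 h⟩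
  · rintro ⟨s, hs, h⟩
    refine ⟨s⁻¹, inv_pos.2 hs, (coe_mul_add_lt_coe_iff (inv_pos.2 hs)).2 ?_⟩
    rwa [inv_inv]

lemma coe_le_perspectiveInf_iff :
    a ≤ perspectiveInf f τ x ↔ ∀ s : ℝ, 0 < s → ((s * a - τ : ℝ) : EReal) ≤ f (s • x) := by
  rw [← not_lt, perspectiveInf_lt_coe_iff]
  simp only [not_exists, not_and, not_lt]

lemma perspectiveInf_le_coe_of_map_smul_le {s : ℝ} (hs : 0 < s)
    (h : f (s • x) ≤ ((s * a - τ : ℝ) : EReal)) : perspectiveInf f τ x ≤ a := by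
  refine EReal.le_of_forall_lt_iff_le.1 fun b hb => ?_
  refine (perspectiveInf_lt_coe_iff.2 ⟨s, hs, h.trans_lt (EReal.coe_lt_coe_iff.2 ?_)⟩).le
  have hab : a < b := EReal.coe_lt_coe_iff.1 hb
  gcongr

lemma perspectiveInf_le_coe_of_forall (h : ∀ s : ℝ, 0 < s → f (s • x) ≤ ((s * c : ℝ) : EReal)) :
    perspectiveInf f τ x ≤ c := by
  refine EReal.le_of_forall_lt_iff_le.1 fun a ha => ?_
  have hca : 0 < a - c := sub_pos.2 (EReal.coe_lt_coe_iff.1 ha)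
  obtain ⟨s, hs, hτs⟩ : ∃ s : ℝ, 0 < s ∧ τ < s * (a - c) :=
    ⟨(|τ| + 1) / (a - c), by positivity, by
      rw [div_mul_cancel₀ _ hca.ne']
      exact (le_abs_self τ).trans_lt (lt_add_one _)⟩
  refine (perspectiveInf_lt_coe_iff.2 ⟨s, hs, (h s hs).trans_lt ?_⟩).le
  rw [EReal.coe_lt_coe_iff]
  linarith

lemma coe_le_perspectiveInf_of_forall (hτ : 0 ≤ τ)
    (h : ∀ s : ℝ, 0 < s → ((s * c : ℝ) : EReal) ≤ f (s • x)) :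
    c ≤ perspectiveInf f τ x :=
  coe_le_perspectiveInf_iff.2 fun s hs =>
    (EReal.coe_le_coe_iff.2 (sub_le_self _ hτ)).trans (h s hs)

lemma perspectiveInf_eq_coe_of_forall (hτ : 0 ≤ τ)
    (h : ∀ s : ℝ, 0 < s → f (s • x) = ((s * c : ℝ) : EReal)) :
    perspectiveInf f τ x = c :=
  (perspectiveInf_le_coe_of_forall fun s hs => (h s hs).le).antisymm
    (coe_le_perspectiveInf_of_forall hτ fun s hs => (h s hs).ge)

lemma perspectiveInf_zero (hτ : 0 ≤ τ) (hf₀ : f 0 = 0) : perspectiveInf f τ 0 = 0 :=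
  perspectiveInf_eq_coe_of_forall hτ fun s _ => by rw [smul_zero, hf₀, mul_zero, EReal.coe_zero]

lemma perspectiveInf_smul_of_pos {t : ℝ} (ht : 0 < t) :
    perspectiveInf f τ (t • x) = (t : EReal) * perspectiveInf f τ x := by
  have lt_coe_iff (a : ℝ) :
      perspectiveInf f τ (t • x) < a ↔ (t : EReal) * perspectiveInf f τ x < a := by
    have mul_lt_iff : (t : EReal) * perspectiveInf f τ x < a ↔
        perspectiveInf f τ x < ((t⁻¹ * a : ℝ) : EReal) := by
      simpa using coe_mul_add_lt_coe_iff (τ := 0) (a := a) (y := perspectiveInf f τ x) ht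
    rw [mul_lt_iff, perspectiveInf_lt_coe_iff, perspectiveInf_lt_coe_iff]
    constructor
    · rintro ⟨s, hs, h⟩
      refine ⟨s * t, mul_pos hs ht, ?_⟩
      rwa [mul_smul, mul_assoc, mul_inv_cancel_left₀ ht.ne']
    · rintro ⟨s, hs, h⟩
      refine ⟨s * t⁻¹, mul_pos hs (inv_pos.2 ht), ?_⟩
      rwa [smul_smul, inv_mul_cancel_right₀ ht.ne', mul_assoc]
  exact (EReal.le_of_forall_lt_iff_le.1 fun a h => ((lt_coe_iff a).2 h).le).antisymm
    (EReal.le_of_forall_lt_iff_le.1 fun a h => ((lt_coe_iff a).1 h).le)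

lemma perspectiveInf_smul (hτ : 0 ≤ τ) (hf₀ : f 0 = 0) (x : E) {t : ℝ} (ht : 0 ≤ t) :
    perspectiveInf f τ (t • x) = (t : EReal) * perspectiveInf f τ x := by
  rcases ht.eq_or_lt with rfl | ht
  · rw [zero_smul, perspectiveInf_zero hτ hf₀, EReal.coe_zero, zero_mul]
  · exact perspectiveInf_smul_of_pos ht

lemma IsConvex.perspectiveInf_add_le_coe (hf : IsConvex f) {b : ℝ}
    (hx : perspectiveInf f τ x < a) (hy : perspectiveInf f τ y < b) :
    perspectiveInf f τ (x + y) ≤ ((a + b : ℝ) : EReal) := by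
  obtain ⟨s, hs, hsx⟩ := perspectiveInf_lt_coe_iff.1 hx
  obtain ⟨t, ht, hty⟩ := perspectiveInf_lt_coe_iff.1 hy
  have hst : 0 < s + t := add_pos hs ht
  have hle := hf.map_add_le_coe (div_nonneg ht.le hst.le)
    ((div_le_one hst).2 (le_add_of_nonneg_left hs.le)) hsx.le hty.le
  have point_eq : (t / (s + t)) • s • x + (1 - t / (s + t)) • t • y
      = (s * t / (s + t)) • (x + y) := by
    rw [smul_smul, smul_smul, smul_add]
    congr 2 <;> field_simp
    ring
  have bound_eq : t / (s + t) * (s * a - τ) + (1 - t / (s + t)) * (t * b - τ)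
      = s * t / (s + t) * (a + b) - τ := by
    field_simp
    ring
  rw [point_eq, bound_eq] at hle
  exact perspectiveInf_le_coe_of_map_smul_le (div_pos (mul_pos hs ht) hst) hle

lemma IsConvex.perspectiveInf_add_le (hf : IsConvex f) (hx : perspectiveInf f τ x ≠ ⊥)
    (hy : perspectiveInf f τ y ≠ ⊥) :
    perspectiveInf f τ (x + y) ≤ perspectiveInf f τ x + perspectiveInf f τ y := by
  refine EReal.le_add_of_forall_gt (.inl hx) (.inr hy) fun u hu v hv => ?_
  obtain ⟨a, hxa, hau⟩ := EReal.lt_iff_exists_real_btwn.1 hu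
  obtain ⟨b, hyb, hbv⟩ := EReal.lt_iff_exists_real_btwn.1 hv
  calc perspectiveInf f τ (x + y) ≤ ((a + b : ℝ) : EReal) :=
        hf.perspectiveInf_add_le_coe hxa hyb
    _ ≤ u + v := by
        rw [EReal.coe_add]
        exact add_le_add hau.le hbv.le

lemma IsConvex.isConvex_perspectiveInf (hf : IsConvex f) (hτ : 0 ≤ τ) (hf₀ : f 0 = 0)
    (hbot : ∀ x, perspectiveInf f τ x ≠ ⊥) : IsConvex (perspectiveInf f τ) := by
  intro x y a ha₀ ha₁
  rw [← perspectiveInf_smul hτ hf₀ x ha₀, ← perspectiveInf_smul hτ hf₀ y (sub_nonneg.2 ha₁)]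
  exact hf.perspectiveInf_add_le (hbot _) (hbot _)

lemma IsConvex.coe_lt_perspectiveInf (hf : IsConvex f) (hf₀ : f 0 ≤ 0) (hτ : 0 < τ)
    (hle : ∀ s : ℝ, 0 < s → ((s * c : ℝ) : EReal) ≤ f (s • x)) {t : ℝ} (ht : 0 < t)
    (hlt : ((t * c : ℝ) : EReal) < f (t • x)) :
    c < perspectiveInf f τ x := by
  obtain ⟨r, htc, hr⟩ := EReal.lt_iff_exists_real_btwn.1 hlt
  have hcr : c < r / t := (lt_div_iff₀' ht).2 (EReal.coe_lt_coe_iff.1 htc)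
  obtain ⟨b, hcb, hb⟩ := exists_between (lt_min hcr (lt_add_of_pos_right c (div_pos hτ ht)))
  obtain ⟨hbr, hbτ⟩ := lt_min_iff.1 hb
  refine (EReal.coe_lt_coe_iff.2 hcb).trans_le (coe_le_perspectiveInf_iff.2 fun s hs => ?_)
  rcases le_total s t with hst | hts
  · refine le_trans (EReal.coe_le_coe_iff.2 ?_) (hle s hs)
    have : s * (b - c) ≤ τ := by
      calc s * (b - c) ≤ t * (b - c) := by gcongr
        _ ≤ t * (τ / t) := by gcongr; linarith
        _ = τ := mul_div_cancel₀ τ ht.ne'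
    linarith
  · have htb : ((t * b : ℝ) : EReal) < f (t • x) :=
      (EReal.coe_lt_coe_iff.2 ((lt_div_iff₀' ht).1 hbr)).trans hr
    exact (EReal.coe_le_coe_iff.2 (sub_le_self _ hτ.le)).trans
      (hf.mul_lt_map_smul_of_le hf₀ ht hts htb).le

end Perspective

section LowerSemicontinuity

variable {E : Type*} [AddCommGroup E] [Module ℝ E] [TopologicalSpace E] [ContinuousSMul ℝ E]
  {f : E → EReal} {τ : ℝ}

lemma eventually_coe_lt_map_smul (hf : LowerSemicontinuous f) {g : ℝ → ℝ} (hg : Continuous g)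
    {x : E} {s : ℝ} (h : (g s : EReal) < f (s • x)) :
    ∀ᶠ q : E × ℝ in 𝓝 (x, s), (g q.2 : EReal) < f (q.2 • q.1) := by
  obtain ⟨r, hgr, hr⟩ := EReal.lt_iff_exists_real_btwn.1 h
  have hsmul : Tendsto (fun q : E × ℝ => q.2 • q.1) (𝓝 (x, s)) (𝓝 (s • x)) :=
    (continuous_snd.smul continuous_fst).tendsto (x, s)
  have hg' : Tendsto (fun q : E × ℝ => g q.2) (𝓝 (x, s)) (𝓝 (g s)) :=
    (hg.comp continuous_snd).tendsto (x, s)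
  filter_upwards [hsmul.eventually (hf _ _ hr),
    hg'.eventually_lt_const (EReal.coe_lt_coe_iff.1 hgr)] with q hfq hgq
  exact (EReal.coe_lt_coe_iff.2 hgq).trans hfq

lemma IsConvex.lowerSemicontinuous_perspectiveInf (hconv : IsConvex f)
    (hlsc : LowerSemicontinuous f) (hf₀ : f 0 = 0) (hτ : 0 < τ) :
    LowerSemicontinuous (perspectiveInf f τ) := by
  intro x y hy
  obtain ⟨a, hya, hax⟩ := EReal.lt_iff_exists_real_btwn.1 hy
  obtain ⟨b, hab, hbx⟩ := EReal.lt_iff_exists_real_btwn.1 hax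
  rw [EReal.coe_lt_coe_iff] at hab
  have hb : ∀ s : ℝ, 0 < s → ((s * b - τ : ℝ) : EReal) ≤ f (s • x) :=
    coe_le_perspectiveInf_iff.1 hbx.le
  have ha : ∀ s : ℝ, 0 ≤ s → ((s * a - τ : ℝ) : EReal) < f (s • x) := by
    intro s hs
    rcases hs.eq_or_lt with rfl | hs
    · rw [zero_smul, hf₀, zero_mul, zero_sub]
      exact_mod_cast neg_neg_of_pos hτ
    · refine lt_of_lt_of_le (EReal.coe_lt_coe_iff.2 ?_) (hb s hs)
      gcongr
  obtain ⟨T, hT, hτT⟩ : ∃ T : ℝ, 0 < T ∧ τ < T * (b - a) :=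
    ⟨(τ + 1) / (b - a), div_pos (by linarith) (sub_pos.2 hab), by
      rw [div_mul_cancel₀ _ (sub_pos.2 hab).ne']
      exact lt_add_one τ⟩
  have hTx : ((T * a : ℝ) : EReal) < f (T • x) :=
    lt_of_lt_of_le (EReal.coe_lt_coe_iff.2 (by linarith)) (hb T hT)
  have eventually_at_T : ∀ᶠ z in 𝓝 x, ((T * a : ℝ) : EReal) < f (T • z) :=
    ((continuous_const_smul T).tendsto x).eventually (hlsc _ _ hTx)
  have eventually_up_to_T :
      ∀ᶠ z in 𝓝 x, ∀ s ∈ Icc 0 T, ((s * a - τ : ℝ) : EReal) < f (s • z) :=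
    isCompact_Icc.eventually_forall_of_forall_eventually fun s hs =>
      eventually_coe_lt_map_smul hlsc (g := fun s => s * a - τ) (by fun_prop) (ha s hs.1)
  filter_upwards [eventually_at_T, eventually_up_to_T] with z hTz hz
  refine hya.trans_le (coe_le_perspectiveInf_iff.2 fun s hs => ?_)
  rcases le_total s T with hsT | hTs
  · exact (hz s ⟨hs.le, hsT⟩).le
  · exact (EReal.coe_le_coe_iff.2 (sub_le_self _ hτ.le)).trans
      (hconv.mul_lt_map_smul_of_le hf₀.le hT hTs hTz).le

end LowerSemicontinuity

section Subregular

variable {E : Type*} [AddCommGroup E] [Module ℝ E] [TopologicalSpace E] {f : E → EReal} {τ : ℝ}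

/-- The common form of the four subregular classes: a closed convex `f` above the linear functional
`φ` that agrees with `φ` on the subspace `N`, and identically on no ray outside `N`. Errors and
deviations have `φ = 0`, regrets and risks `φ = E[·]`; errors and regrets have `N = 0`, deviations
and risks the constants. -/
structure IsSubregular (φ : E →ₗ[ℝ] ℝ) (N : Submodule ℝ E) (f : E → EReal) : Prop where
  convex : IsConvex f
  closed : LowerSemicontinuous f
  le : ∀ x, (φ x : EReal) ≤ f x
  eq_of_mem : ∀ x ∈ N, f x = φ x
  exists_lt_of_notMem : ∀ x ∉ N, ∃ t : ℝ, 0 < t ∧ (φ (t • x) : EReal) < f (t • x)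

namespace IsSubregular

variable {φ : E →ₗ[ℝ] ℝ} {N : Submodule ℝ E}

lemma map_zero (hf : IsSubregular φ N f) : f 0 = 0 := by
  rw [hf.eq_of_mem 0 N.zero_mem, _root_.map_zero, EReal.coe_zero]

lemma mul_le_map_smul (hf : IsSubregular φ N f) (x : E) (s : ℝ) :
    ((s * φ x : ℝ) : EReal) ≤ f (s • x) := by
  rw [← smul_eq_mul, ← map_smul]
  exact hf.le (s • x)

lemma le_perspectiveInf (hf : IsSubregular φ N f) (hτ : 0 ≤ τ) (x : E) :
    φ x ≤ perspectiveInf f τ x :=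
  coe_le_perspectiveInf_of_forall hτ fun s _ => hf.mul_le_map_smul x s

lemma isSubregular_perspectiveInf [ContinuousSMul ℝ E] (hf : IsSubregular φ N f) (hτ : 0 < τ) :
    IsSubregular φ N (perspectiveInf f τ) where
  convex := hf.convex.isConvex_perspectiveInf hτ.le hf.map_zero fun x =>
    ((EReal.bot_lt_coe _).trans_le (hf.le_perspectiveInf hτ.le x)).ne'
  closed := hf.convex.lowerSemicontinuous_perspectiveInf hf.closed hf.map_zero hτ
  le := hf.le_perspectiveInf hτ.le
  eq_of_mem x hx := perspectiveInf_eq_coe_of_forall hτ.le fun s _ => by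
    rw [hf.eq_of_mem _ (N.smul_mem s hx), map_smul, smul_eq_mul]
  exists_lt_of_notMem x hx := by
    obtain ⟨t, ht, hlt⟩ := hf.exists_lt_of_notMem x hx
    rw [map_smul, smul_eq_mul] at hlt
    refine ⟨1, one_pos, ?_⟩
    rw [one_smul]
    exact hf.convex.coe_lt_perspectiveInf hf.map_zero.le hτ
      (fun s _ => hf.mul_le_map_smul x s) ht hlt

end IsSubregular

end Subregular

section Lp

variable {Ω : Type*} [MeasurableSpace Ω] {P : Measure Ω} {p : ℝ≥0∞}

lemma isConstant_iff_mem_range [IsProbabilityMeasure P] {X : Lp ℝ p P} :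
    IsConstant X ↔ X ∈ LinearMap.range (Lp.constₗ p P ℝ : ℝ →ₗ[ℝ] Lp ℝ p P) :=
  exists_congr fun _ => eq_comm

variable [Fact (1 ≤ p)] {F : Lp ℝ p P → EReal}

lemma IsSubregular.isClosedConvex {φ : Lp ℝ p P →ₗ[ℝ] ℝ} {N : Submodule ℝ (Lp ℝ p P)}
    (hF : IsSubregular φ N F) : IsClosedConvex F where
  ne_bot X := ((EReal.bot_lt_coe _).trans_le (hF.le X)).ne'
  convex := hF.convex
  closed := hF.closed

/-- The expectation as a linear functional on `L^p`; its value at `X` is the real number underlying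
`expect X`. -/
noncomputable def expectₗ (P : Measure Ω) [IsFiniteMeasure P] (p : ℝ≥0∞) [Fact (1 ≤ p)] :
    Lp ℝ p P →ₗ[ℝ] ℝ where
  toFun X := ∫ ω, X ω ∂P
  map_add' X Y := by
    rw [integral_congr_ae (Lp.coeFn_add X Y)]
    exact integral_add ((Lp.memLp X).integrable Fact.out) ((Lp.memLp Y).integrable Fact.out)
  map_smul' c X := by
    rw [integral_congr_ae (Lp.coeFn_smul c X)]
    exact integral_smul c X

variable [IsProbabilityMeasure P]

lemma expectₗ_const (c : ℝ) : expectₗ P p (Lp.const p P c) = c :=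
  calc ∫ ω, Lp.const p P c ω ∂P = ∫ _, c ∂P := integral_congr_ae (Lp.coeFn_const p P c)
    _ = c := by rw [integral_const, probReal_univ, one_smul]

lemma isSubregularError_iff : IsSubregularError F ↔ IsSubregular 0 ⊥ F where
  mp h :=
    { convex := h.convex
      closed := h.closed
      le := h.nonneg
      eq_of_mem := by
        rintro X rfl
        exact h.map_zero
      exists_lt_of_notMem := h.subaversity }
  mpr h :=
    { h.isClosedConvex with
      map_zero := h.map_zero
      nonneg := h.le
      subaversity := h.exists_lt_of_notMem }

lemma isSubregularRegret_iff : IsSubregularRegret F ↔ IsSubregular (expectₗ P p) ⊥ F where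
  mp h :=
    { convex := h.convex
      closed := h.closed
      le := h.expect_le
      eq_of_mem := by
        rintro X rfl
        rw [h.map_zero, map_zero, EReal.coe_zero]
      exists_lt_of_notMem := h.subaversity }
  mpr h :=
    { h.isClosedConvex with
      map_zero := h.map_zero
      expect_le := h.le
      subaversity := h.exists_lt_of_notMem }

lemma isSubregularDeviation_iff :
    IsSubregularDeviation F ↔ IsSubregular 0 (LinearMap.range (Lp.constₗ p P ℝ)) F where
  mp h :=
    { convex := h.convex
      closed := h.closed
      le := h.nonneg
      eq_of_mem := by
        rintro _ ⟨c, rfl⟩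
        exact h.map_const c
      exists_lt_of_notMem := fun X hX => h.subaversity X (mt isConstant_iff_mem_range.1 hX) }
  mpr h :=
    { h.isClosedConvex with
      map_const := fun c => h.eq_of_mem _ ⟨c, rfl⟩
      nonneg := h.le
      subaversity := fun X hX => h.exists_lt_of_notMem X (mt isConstant_iff_mem_range.2 hX) }

lemma isSubregularRisk_iff :
    IsSubregularRisk F ↔ IsSubregular (expectₗ P p) (LinearMap.range (Lp.constₗ p P ℝ)) F where
  mp h :=
    { convex := h.convex
      closed := h.closed
      le := h.expect_le
      eq_of_mem := by
        rintro _ ⟨c, rfl⟩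
        exact (h.map_const c).trans (congrArg _ (expectₗ_const c).symm)
      exists_lt_of_notMem := fun X hX => h.subaversity X (mt isConstant_iff_mem_range.1 hX) }
  mpr h :=
    { h.isClosedConvex with
      map_const := fun c => (h.eq_of_mem _ ⟨c, rfl⟩).trans (congrArg _ (expectₗ_const c))
      expect_le := h.le
      subaversity := fun X hX => h.exists_lt_of_notMem X (mt isConstant_iff_mem_range.2 hX) }

end Lp

end RiskQuadrangle

theorem mainTheorem8_general {E : Type*} [AddCommGroup E] [Module ℝ E] [TopologicalSpace E]
    [ContinuousSMul ℝ E] (φ : E →ₗ[ℝ] ℝ) (N : Submodule ℝ E) (f : E → EReal) (τ : ℝ) (hτ : 0 < τ)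
    (hf : RiskQuadrangle.IsSubregular φ N f) :
    (∀ (x : E) (t : ℝ), 0 ≤ t → RiskQuadrangle.perspectiveInf f τ (t • x)
      = (t : EReal) * RiskQuadrangle.perspectiveInf f τ x) ∧
    RiskQuadrangle.IsSubregular φ N (RiskQuadrangle.perspectiveInf f τ) :=
  ⟨fun x _ ht => RiskQuadrangle.perspectiveInf_smul hτ.le hf.map_zero x ht,
    hf.isSubregular_perspectiveInf hτ⟩

theorem mainTheorem8 {Ω : Type*} [MeasurableSpace Ω] (P : Measure Ω) [IsProbabilityMeasure P]
    (p : ℝ≥0∞) [Fact (1 ≤ p)] (F : Lp ℝ p P → EReal) (τ : ℝ) (hτ : 0 < τ) :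
    (RiskQuadrangle.IsSubregularError F →
      RiskQuadrangle.IsPosHomogeneous (RiskQuadrangle.perspectiveFamily F τ) ∧
      RiskQuadrangle.IsSubregularError (RiskQuadrangle.perspectiveFamily F τ)) ∧
    (RiskQuadrangle.IsSubregularRegret F →
      RiskQuadrangle.IsPosHomogeneous (RiskQuadrangle.perspectiveFamily F τ) ∧
      RiskQuadrangle.IsSubregularRegret (RiskQuadrangle.perspectiveFamily F τ)) ∧
    (RiskQuadrangle.IsSubregularDeviation F →
      RiskQuadrangle.IsPosHomogeneous (RiskQuadrangle.perspectiveFamily F τ) ∧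
      RiskQuadrangle.IsSubregularDeviation (RiskQuadrangle.perspectiveFamily F τ)) ∧
    (RiskQuadrangle.IsSubregularRisk F →
      RiskQuadrangle.IsPosHomogeneous (RiskQuadrangle.perspectiveFamily F τ) ∧
      RiskQuadrangle.IsSubregularRisk (RiskQuadrangle.perspectiveFamily F τ)) := by
  simp only [RiskQuadrangle.isSubregularError_iff, RiskQuadrangle.isSubregularRegret_iff,
    RiskQuadrangle.isSubregularDeviation_iff, RiskQuadrangle.isSubregularRisk_iff]
  exact ⟨mainTheorem8_general _ _ F τ hτ, mainTheorem8_general _ _ F τ hτ,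
    mainTheorem8_general _ _ F τ hτ, mainTheorem8_general _ _ F τ hτ⟩
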